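/- Let $(\Omega,\mathcal F,\mathbb P)$ be a probability space carrying a standard Brownian motion $W=(W_t)_{t\ge 0}$, let $\mu\in\mathbb R$, $\sigma>0$, $\beta>0$, and for $x>0$ let $X^x_t = x\exp\big((\mu-\tfrac{\sigma^2}{2})t+\sigma W_t\big)$, $t\ge0$, be the geometric Brownian motion started at $x$ (the solution of $dX_t=\mu X_t\,dt+\sigma X_t\,dW_t$, $X_0=x$), with state space $\mathbb X=(0,\infty)$. Take the payoff function $f(x)=x$ on $\mathbb X$ and the hyperbolic discount function $\delta(t)=\frac{1}{1+\beta t}$, $t\ge 0$. For a Borel set $R\subseteq\mathbb X$ (a stopping policy) and $x\in\mathbb X$, let $\rho(x,R)=\inf\{t>0: X^x_t\in R\}\in[0,\infty]$ and $$J(x,R)=\mathbb E\big[\delta(\rho(x,R))\,f(X^x_{\rho(x,R)})\big]\in[0,\infty],$$ where on $\{\rho(x,R)=\infty\}$ the integrand is read as $\limsup_{t\to\infty}\delta(t)f(X^x_t)$. Put $$\Theta(R)=\{x\in\mathbb X: f(x)>J(x,R)\}\cup\big(\{x\in\mathbb X: f(x)=J(x,R)\}\cap R\big),\qquad V(x,R)=\max\{f(x),J(x,R)\}.$$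 A Borel set $R\subseteq\mathbb X$ is called an equilibrium if $\Theta(R)=R$. An equilibrium $\hat R$ is called optimal if $V(x,\hat R)\ge V(x,R)$ for every equilibrium $R$ and every $x\in\mathbb X$. Let $R^*$ be the intersection of all equilibria that are closed in $\mathbb X$. Suppose that $\nu:=\frac{\mu}{\sigma^2}-\frac12>0$. Then $J(x,\emptyset)=\infty$ for every $x>0$, the empty set (never stopping) is an optimal equilibrium, and $R^*=\emptyset$. -/

import Mathlib

open MeasureTheory ProbabilityTheory Filter
open scoped NNReal ENNReal

namespace StoppingGame

noncomputable section

/-! ### Stopping policies and equilibria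

`𝕏` is the state space, `X x t` is the state at time `t` of the process started at `x`, `δ` is the
discount function and `f` the payoff function.  A stopping policy is a (Borel) set `R` of states.
Since `δ` and `f` are nonnegative, expected payoffs are computed in `[0, ∞]`. -/

section General

variable {Ω 𝕏 : Type*}

/-- `inf {t > 0 : Y t ∈ R}`, the first strictly positive time at which the path is in `R`
(`∞` if there is none). -/
def entryTime (Y : ℝ≥0 → Ω → 𝕏) (R : Set 𝕏) (ω : Ω) : ℝ≥0∞ :=
  sInf ((fun t : ℝ≥0 => (t : ℝ≥0∞)) '' {t : ℝ≥0 | 0 < t ∧ Y t ω ∈ R})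

/-- The discounted payoff `δ(τ) f(Y_τ)` of stopping at time `τ`.  If `τ = ∞` this is
`limsup_{t → ∞} δ(t) f(Y_t)`. -/
def discountedPayoff (δ : ℝ≥0 → ℝ) (f : 𝕏 → ℝ) (Y : ℝ≥0 → Ω → 𝕏) (τ : ℝ≥0∞) (ω : Ω) : ℝ≥0∞ :=
  if τ = ∞ then limsup (fun t : ℝ≥0 => ENNReal.ofReal (δ t * f (Y t ω))) atTop
  else ENNReal.ofReal (δ τ.toNNReal * f (Y τ.toNNReal ω))

variable [MeasurableSpace Ω] (P : Measure Ω) (X : 𝕏 → ℝ≥0 → Ω → 𝕏) (δ : ℝ≥0 → ℝ) (f : 𝕏 → ℝ)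

/-- `J(x, R)`: the expected discounted payoff, from the state `x`, of stopping at the first positive
time at which the process is in `R`. -/
def J (x : 𝕏) (R : Set 𝕏) : ℝ≥0∞ :=
  ∫⁻ ω, discountedPayoff δ f (X x) (entryTime (X x) R ω) ω ∂P

/-- The stopping region `S_R = {x : f(x) > J(x, R)}`. -/
def stoppingRegion (R : Set 𝕏) : Set 𝕏 := {x | J P X δ f x R < ENNReal.ofReal (f x)}

/-- The indifference region `I_R = {x : f(x) = J(x, R)}`. -/
def indifferenceRegion (R : Set 𝕏) : Set 𝕏 := {x | ENNReal.ofReal (f x) = J P X δ f x R}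

/-- The best response `Θ(R) = S_R ∪ (I_R ∩ R)` to the policy `R`. -/
def bestResponse (R : Set 𝕏) : Set 𝕏 :=
  stoppingRegion P X δ f R ∪ (indifferenceRegion P X δ f R ∩ R)

/-- The value `V(x, R) = max (f(x)) (J(x, R))`. -/
def value (x : 𝕏) (R : Set 𝕏) : ℝ≥0∞ := max (ENNReal.ofReal (f x)) (J P X δ f x R)

/-- An equilibrium is a Borel set `R` with `Θ(R) = R`. -/
def IsEquilibrium [MeasurableSpace 𝕏] (R : Set 𝕏) : Prop :=
  MeasurableSet R ∧ bestResponse P X δ f R = R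

/-- An optimal equilibrium is an equilibrium whose value dominates that of every other equilibrium
at every state. -/
def IsOptimalEquilibrium [MeasurableSpace 𝕏] (R : Set 𝕏) : Prop :=
  IsEquilibrium P X δ f R ∧
    ∀ T : Set 𝕏, IsEquilibrium P X δ f T → ∀ x : 𝕏, value P X δ f x T ≤ value P X δ f x R

/-- `R*`: the intersection of all equilibria that are closed in the state space. -/
def RStar [MeasurableSpace 𝕏] [TopologicalSpace 𝕏] : Set 𝕏 :=
  ⋂₀ {R : Set 𝕏 | IsEquilibrium P X δ f R ∧ IsClosed R}

end General

/-! ### Geometric Brownian motion with hyperbolic discounting -/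

/-- The state space `(0, ∞)`, with its subspace topology and Borel σ-algebra. -/
abbrev PosReal : Type := Set.Ioi (0 : ℝ)

/-- Geometric Brownian motion with drift `μ` and volatility `σ`, started at `x` and driven by `W`:
`X_t = x exp ((μ - σ²/2) t + σ W_t)`, the solution of `dX = μ X dt + σ X dW`, `X_0 = x`. -/
def gbm {Ω : Type*} (μ σ : ℝ) (W : ℝ≥0 → Ω → ℝ) (x : PosReal) (t : ℝ≥0) (ω : Ω) : PosReal :=
  ⟨(x : ℝ) * Real.exp ((μ - σ ^ 2 / 2) * (t : ℝ) + σ * W t ω), mul_pos x.2 (Real.exp_pos _)⟩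

/-- The hyperbolic discount function `δ(t) = 1 / (1 + β t)`. -/
def hyperbolicDiscount (β : ℝ) (t : ℝ≥0) : ℝ := 1 / (1 + β * (t : ℝ))

/-- The payoff function `f(x) = x` on `(0, ∞)`. -/
def identityPayoff (x : PosReal) : ℝ := x

end

end StoppingGame

/-! The condition on `ν` says that `c = μ - σ²/2` is positive. Whenever `W n ≥ 0`, the process at
time `n` is at least `x * exp (c * n)`, which outgrows `1 + β * n`. So no almost sure growth rate is
needed: symmetry of the Gaussian marginals makes `W n ≥ 0` infinitely often with probability at
least one half, and there the limsup is infinite. Infinite `J` leaves nothing to stop for and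
dominates every value; as `∅` is closed, it also forces `RStar` to be empty. -/

/-- A centred real Gaussian is negative with probability at most one half. -/
theorem gaussianReal_zero_Iio_zero_le (v : ℝ≥0) :
    gaussianReal 0 v (Set.Iio 0) ≤ 2⁻¹ := by
  have hsymm : gaussianReal 0 v (Set.Iio 0) = gaussianReal 0 v (Set.Ioi 0) := by
    have h := gaussianReal_map_neg (μ := 0) (v := v)
    rw [neg_zero] at h
    conv_lhs => rw [← h, Measure.map_apply measurable_neg measurableSet_Iio]
    congr 1
    ext y
    simp
  -- Not an equality: `v = 0`, the law at time 0, is a Dirac mass at 0.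
  have hadd : gaussianReal 0 v (Set.Iio 0) + gaussianReal 0 v (Set.Ioi 0) ≤ 1 := by
    have hdisj : Disjoint (Set.Iio (0 : ℝ)) (Set.Ioi 0) :=
      Set.disjoint_left.2 fun y hy hy' => lt_asymm (Set.mem_Iio.1 hy) (Set.mem_Ioi.1 hy')
    rw [← measure_union hdisj measurableSet_Ioi]
    exact prob_le_one
  rw [← hsymm, ← two_mul, mul_comm] at hadd
  rw [← one_div]
  exact (ENNReal.le_div_iff_mul_le (by simp) (by simp)).2 hadd

/-- With positive probability, a Brownian motion is nonnegative at infinitely many integer times. -/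
theorem measure_eventually_brownian_neg_le {Ω : Type*} [MeasurableSpace Ω] {P : Measure Ω}
    {W : ℝ≥0 → Ω → ℝ} (hW : IsPreBrownianReal W P) :
    P {ω | ∀ᶠ n : ℕ in atTop, W n ω < 0} ≤ 2⁻¹ := by
  have hset : {ω | ∀ᶠ n : ℕ in atTop, W n ω < 0} =
      ⋃ N : ℕ, {ω | ∀ n ≥ N, W (n : ℝ≥0) ω < 0} := by
    ext ω
    simp [eventually_atTop]
  have hmono : Monotone fun N : ℕ => {ω | ∀ n ≥ N, W (n : ℝ≥0) ω < 0} :=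
    fun M N hMN ω hω n hn => hω n (hMN.trans hn)
  -- By continuity from below a bound uniform in `N` is enough, and the marginal at time `N` alone
  -- gives it.
  rw [hset, hmono.measure_iUnion]
  refine iSup_le fun N => ?_
  calc P {ω | ∀ n ≥ N, W (n : ℝ≥0) ω < 0}
      ≤ P (W (N : ℝ≥0) ⁻¹' Set.Iio 0) := measure_mono fun ω hω => hω N le_rfl
    _ = gaussianReal 0 N (Set.Iio 0) := by
        rw [← (hW.hasLaw_eval N).map_eq,
          Measure.map_apply_of_aemeasurable (hW.aemeasurable N) measurableSet_Iio]
    _ ≤ 2⁻¹ := gaussianReal_zero_Iio_zero_le _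

namespace StoppingGame

/-- The first entry time into the empty set is infinite. -/
theorem entryTime_empty {Ω 𝕏 : Type*} (Y : ℝ≥0 → Ω → 𝕏) (ω : Ω) : entryTime Y ∅ ω = ∞ := by
  simp [entryTime]

/-- Exponential growth beats hyperbolic discounting. -/
theorem tendsto_mul_exp_div_one_add_mul_atTop {x c β : ℝ} (hx : 0 < x) (hc : 0 < c) (hβ : 0 < β) :
    Tendsto (fun n : ℕ => x * Real.exp (c * n) / (1 + β * n)) atTop atTop := by
  -- Linear minorant: keep the quadratic term of `exp` and use `1 + β * n ≤ (1 + β) * n` for `n ≥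
  -- 1`.
  refine tendsto_atTop_mono' _ ?_
    ((tendsto_natCast_atTop_atTop (R := ℝ)).const_mul_atTop
      (show 0 < x * c ^ 2 / 2 / (1 + β) by positivity))
  filter_upwards [eventually_ge_atTop 1] with n hn
  have hn' : (1 : ℝ) ≤ n := by exact_mod_cast hn
  have hexp : (c * n) ^ 2 / 2 ≤ Real.exp (c * n) := by
    have := Real.quadratic_le_exp_of_nonneg (show 0 ≤ c * n by positivity)
    have : 0 ≤ c * n := by positivity
    linarith
  rw [le_div_iff₀ (by positivity)]
  calc x * c ^ 2 / 2 / (1 + β) * n * (1 + β * n)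
      ≤ x * c ^ 2 / 2 / (1 + β) * n * ((1 + β) * n) := by gcongr; linarith
    _ = x * ((c * n) ^ 2 / 2) := by field_simp
    _ ≤ x * Real.exp (c * n) := by gcongr

/-- If the driving path is nonnegative at infinitely many integer times, then never stopping has an
infinite discounted payoff. -/
theorem discountedPayoff_gbm_top_eq_top {Ω : Type*} {W : ℝ≥0 → Ω → ℝ} {μ σ β : ℝ} (hσ : 0 < σ)
    (hβ : 0 < β) (hdrift : 0 < μ - σ ^ 2 / 2) (x : PosReal) {ω : Ω}
    (hω : ∃ᶠ n : ℕ in atTop, 0 ≤ W n ω) :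
    discountedPayoff (hyperbolicDiscount β) identityPayoff (gbm μ σ W x) ∞ ω = ∞ := by
  have hx : 0 < (x : ℝ) := x.2
  rw [discountedPayoff, if_pos rfl]
  refine ENNReal.eq_top_of_forall_nnreal_le fun K => ?_
  refine le_limsup_of_frequently_le ?_
  have hlarge := (tendsto_mul_exp_div_one_add_mul_atTop hx hdrift hβ).eventually_ge_atTop (K : ℝ)
  refine (tendsto_natCast_atTop_atTop (R := ℝ≥0)).frequently ((hω.and_eventually hlarge).mono ?_)
  rintro n ⟨hn, hK⟩
  rw [← ENNReal.ofReal_coe_nnreal]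
  refine ENNReal.ofReal_le_ofReal (hK.trans ?_)
  rw [hyperbolicDiscount, identityPayoff, gbm, one_div_mul_eq_div]
  push_cast
  gcongr
  exact le_add_of_nonneg_right (mul_nonneg hσ.le hn)

/-- If `μ > σ² / 2`, never stopping has an infinite expected payoff. -/
theorem J_gbm_empty {Ω : Type*} [MeasurableSpace Ω] {P : Measure Ω} [IsProbabilityMeasure P]
    {W : ℝ≥0 → Ω → ℝ} (hW : IsPreBrownianReal W P) {μ σ β : ℝ} (hσ : 0 < σ) (hβ : 0 < β)
    (hdrift : 0 < μ - σ ^ 2 / 2) (x : PosReal) :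
    J P (gbm μ σ W) (hyperbolicDiscount β) identityPayoff x ∅ = ∞ := by
  set B : Set Ω := {ω | ∀ᶠ n : ℕ in atTop, W n ω < 0} with hB
  -- Each `W n` is only used as a.e. measurable, hence null measurability.
  have hBmeas : NullMeasurableSet B P := by
    have hset : B = ⋃ N : ℕ, ⋂ n ≥ N, W (n : ℝ≥0) ⁻¹' Set.Iio 0 := by
      ext ω
      simp [hB, eventually_atTop]
    rw [hset]
    exact .iUnion fun N => .iInter fun n => .iInter fun _ =>
      (hW.aemeasurable n).nullMeasurableSet_preimage measurableSet_Iio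
  have hpos : P Bᶜ ≠ 0 := by
    intro h0
    have hone : P B = 1 := (prob_compl_eq_zero_iff₀ hBmeas).1 h0
    have hle : P B ≤ 2⁻¹ := measure_eventually_brownian_neg_le hW
    rw [hone] at hle
    exact absurd hle (not_le.2 (ENNReal.inv_lt_one.2 ENNReal.one_lt_two))
  rw [eq_top_iff]
  calc ∞ = ∫⁻ ω, Bᶜ.indicator (fun _ => ∞) ω ∂P := by
        rw [lintegral_indicator_const₀ hBmeas.compl, ENNReal.top_mul hpos]
    _ ≤ J P (gbm μ σ W) (hyperbolicDiscount β) identityPayoff x ∅ := by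
        -- Monotonicity of the lower integral needs no measurability of the payoff.
        refine lintegral_mono fun ω => Set.indicator_apply_le fun hω => ?_
        rw [entryTime_empty, discountedPayoff_gbm_top_eq_top hσ hβ hdrift x]
        exact (not_eventually.1 hω).mono fun n hn => not_lt.1 hn

end StoppingGame

theorem proposition6p2 {Ω : Type*} [MeasurableSpace Ω] (P : Measure Ω) [IsProbabilityMeasure P]
    (W : ℝ≥0 → Ω → ℝ) (hW : IsBrownianReal W P)
    (μ σ β : ℝ) (hσ : 0 < σ) (hβ : 0 < β) (hν : 0 < μ / σ ^ 2 - 1 / 2) :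
    (∀ x : StoppingGame.PosReal,
      StoppingGame.J P (StoppingGame.gbm μ σ W) (StoppingGame.hyperbolicDiscount β)
        StoppingGame.identityPayoff x ∅ = ∞) ∧
    StoppingGame.IsOptimalEquilibrium P (StoppingGame.gbm μ σ W)
      (StoppingGame.hyperbolicDiscount β) StoppingGame.identityPayoff ∅ ∧
    StoppingGame.RStar P (StoppingGame.gbm μ σ W)
      (StoppingGame.hyperbolicDiscount β) StoppingGame.identityPayoff = ∅ := by
  have hdrift : 0 < μ - σ ^ 2 / 2 := by
    have h : μ - σ ^ 2 / 2 = σ ^ 2 * (μ / σ ^ 2 - 1 / 2) := by field_simp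
    rw [h]
    positivity
  have hJ := StoppingGame.J_gbm_empty hW.toIsPreBrownianReal hσ hβ hdrift
  have hEq : StoppingGame.IsEquilibrium P (StoppingGame.gbm μ σ W)
      (StoppingGame.hyperbolicDiscount β) StoppingGame.identityPayoff ∅ := by
    refine ⟨MeasurableSet.empty, Set.eq_empty_of_forall_notMem fun x hx => ?_⟩
    rcases hx with hx | hx
    · rw [StoppingGame.stoppingRegion, Set.mem_ofPred_eq, hJ x] at hx
      exact not_top_lt hx
    · exact hx.2
  refine ⟨hJ, ⟨hEq, fun T _ x => ?_⟩, ?_⟩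
  · rw [StoppingGame.value, StoppingGame.value, hJ x, max_eq_right le_top]
    exact le_top
  · exact Set.subset_empty_iff.1 (Set.sInter_subset_of_mem ⟨hEq, isClosed_empty⟩)
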